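/- Setting. Let $D$ be the space of distribution functions of probability distributions with support in $[0,1]$, with the L\'evy metric $d_L$ and its Borel $\sigma$-field. For a finite set $S$ let $D_S=D^S$ carry the metric $d_{L_u}(F,G)=\sup_{x\in S}d_L(F_x,G_x)$. For laws $\mu,\nu$ on $D_S$ let $d_P(\mu,\nu)$ be the Prokhorov metric built on $d_{L_u}$, and let $d_{P_u}(\mu,\nu)=\sup_{x\in S}d_P(\mu_x,\nu_x)$, where $\mu_x,\nu_x$ are the marginals at $x$. Let $\emptyset=\mathcal T_0\subseteq\mathcal T_1\subseteq\mathcal T_2\subseteq\cdots$ be finite subsets of $(0,1)$; $\mathcal T_m$ is the set of quantile levels specified in the first $m$ levels of the pyramid, and $\{0,1\}\cup\mathcal T_m$ is the set of nodes. Let $\mathcal X$ be any index set (the covariate space) and let $(\Omega,\mathcal B,P)$ be a probability space. Whenever two neighbouring nodes $a<b$ of level $m-1$ have new levels $\tau_1<\dots<\tau_K$ ($K\ge1$) of $\mathcal T_m$ between them, let $V_{x,1},\dots,V_{x,K+1}$ ($x\in\mathcal X$) be real random variables on $\Omega$ (depending on $m$ and $a$) such that for each $x$, almost surely, $0<V_{x,k}<1$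 and $\sum_{k=1}^{K+1}V_{x,k}=1$; no other assumption is made on their joint law. Put $Q_x(0)=0$, $Q_x(1)=1$ and, recursively, $Q_x(\tau_k)=Q_x(a)\bigl(1-\sum_{j\le k}V_{x,j}\bigr)+Q_x(b)\sum_{j\le k}V_{x,j}$. Let $Q_x^m:[0,1]\to[0,1]$ be the linear interpolation of $Q_x$ between the nodes of level $m$ (the $m$-level finite dependent quantile pyramid), let $F_x^m\in D$ be the distribution function with quantile function $Q_x^m$, and for finite $S\subseteq\mathcal X$ let $\mu_m^S$ be the law of $(F^m_x)_{x\in S}$ on $D_S$. Theorem. Suppose that $\bigcup_{m}\mathcal T_m$ is dense in $[0,1]$. Then for every finite $S\subseteq\mathcal X$ there is exactly one probability measure $\mu^S$ on $D_S$ with $d_P(\mu_m^S,\mu^S)\to0$ as $m\to\infty$, and also $d_{P_u}(\mu_m^S,\mu^S)\to0$. The laws $\mu^S$ are consistent: for $S'\subseteq S$, $\mu^{S'}$ is the image of $\mu^S$ under restriction. There is a $D$-valued stochastic process $(F_x)_{x\in\mathcal X}$ on $(\Omega,\mathcal B,P)$ whose finite-dimensional laws are exactly the $\mu^S$. For each $x$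 it satisfies, almost surely, $d_L(F_x^m,F_x)\to0$ and $F_x(y)\le\tau\le F_x(Q_x(\tau))$ for all $\tau\in\bigcup_m\mathcal T_m$ and all $y<Q_x(\tau)$, so that every specified $Q_x(\tau)$ is a $\tau$-quantile of $F_x$. -/

import Mathlib

open MeasureTheory Filter Topology

noncomputable section

namespace QuantilePyramid

/-! ## Distributions on the unit interval and the Lévy metric -/

/-- The space `D` of probability distributions with support in `[0, 1]`, given by their
(nondecreasing, right-continuous) distribution functions. -/
structure UnitDist extends StieltjesFunction ℝ where
  eq_zero_of_neg : ∀ y : ℝ, y < 0 → toFun y = 0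
  eq_one_of_one_le : ∀ y : ℝ, 1 ≤ y → toFun y = 1

namespace UnitDist

/-- The distribution function of `F`. -/
def cdf (F : UnitDist) : ℝ → ℝ := F.toFun

theorem cdf_mono (F : UnitDist) : Monotone F.cdf := F.mono'

theorem cdf_rightCont (F : UnitDist) (y : ℝ) : ContinuousWithinAt F.cdf (Set.Ici y) y :=
  F.right_continuous' y

theorem cdf_nonneg (F : UnitDist) (y : ℝ) : 0 ≤ F.cdf y := by
  have h : F.cdf (min y (-1)) = 0 := F.eq_zero_of_neg _ (by
    have := min_le_right y (-1 : ℝ)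
    linarith)
  rw [← h]
  exact F.cdf_mono (min_le_left _ _)

theorem cdf_le_one (F : UnitDist) (y : ℝ) : F.cdf y ≤ 1 := by
  have h : F.cdf (max y 1) = 1 := F.eq_one_of_one_le _ (le_max_right _ _)
  rw [← h]
  exact F.cdf_mono (le_max_left _ _)

theorem ext_cdf {F G : UnitDist} (h : ∀ y, F.cdf y = G.cdf y) : F = G := by
  obtain ⟨⟨f, hf1, hf2⟩, hf3, hf4⟩ := F
  obtain ⟨⟨g, hg1, hg2⟩, hg3, hg4⟩ := G
  have : f = g := funext h
  subst this
  rfl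

/-- The set of `ε > 0` that are admissible in the definition of the Lévy distance. -/
def levySet (F G : UnitDist) : Set ℝ :=
  {ε | 0 < ε ∧ ∀ y, F.cdf (y - ε) - ε ≤ G.cdf y ∧ G.cdf y ≤ F.cdf (y + ε) + ε}

/-- The Lévy metric `d_L`. -/
def levyDist (F G : UnitDist) : ℝ := sInf (levySet F G)

theorem levySet_bddBelow (F G : UnitDist) : BddBelow (levySet F G) :=
  ⟨0, fun _ h => h.1.le⟩

theorem levySet_nonempty (F G : UnitDist) : (levySet F G).Nonempty := by
  refine ⟨1, one_pos, fun y => ⟨?_, ?_⟩⟩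
  · linarith [F.cdf_le_one (y - 1), G.cdf_nonneg y]
  · linarith [F.cdf_nonneg (y + 1), G.cdf_le_one y]

theorem levySet_symm {F G : UnitDist} {ε : ℝ} (h : ε ∈ levySet F G) : ε ∈ levySet G F := by
  refine ⟨h.1, fun y => ⟨?_, ?_⟩⟩
  · have := (h.2 (y - ε)).2
    rw [sub_add_cancel] at this
    linarith
  · have := (h.2 (y + ε)).1
    rw [add_sub_cancel_right] at this
    linarith

theorem levySet_add {F G H : UnitDist} {ε δ : ℝ} (h : ε ∈ levySet F G) (k : δ ∈ levySet G H) :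
    ε + δ ∈ levySet F H := by
  refine ⟨add_pos h.1 k.1, fun y => ⟨?_, ?_⟩⟩
  · have h1 := (h.2 (y - δ)).1
    have h2 := (k.2 y).1
    have : y - (ε + δ) = y - δ - ε := by ring
    rw [this]
    linarith
  · have h1 := (h.2 (y + δ)).2
    have h2 := (k.2 y).2
    have : y + (ε + δ) = y + δ + ε := by ring
    rw [this]
    linarith

theorem levyDist_self (F : UnitDist) : levyDist F F = 0 := by
  have hm : ∀ ε : ℝ, 0 < ε → ε ∈ levySet F F := fun ε hε =>
    ⟨hε, fun y => ⟨by linarith [F.cdf_mono (show y - ε ≤ y by linarith)],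
      by linarith [F.cdf_mono (show y ≤ y + ε by linarith)]⟩⟩
  refine le_antisymm (le_of_forall_pos_le_add fun ε hε => ?_)
    (Real.sInf_nonneg fun _ h => h.1.le)
  rw [zero_add]
  exact csInf_le (levySet_bddBelow F F) (hm ε hε)

theorem levyDist_comm (F G : UnitDist) : levyDist F G = levyDist G F :=
  congrArg sInf (Set.ext fun _ => ⟨levySet_symm, levySet_symm⟩)

theorem levyDist_triangle (F G H : UnitDist) :
    levyDist F H ≤ levyDist F G + levyDist G H := by
  refine le_of_forall_pos_le_add fun r hr => ?_
  obtain ⟨ε, hε, hε'⟩ := exists_lt_of_csInf_lt (levySet_nonempty F G)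
    (show sInf (levySet F G) < levyDist F G + r / 2 by
      change levyDist F G < _
      linarith)
  obtain ⟨δ, hδ, hδ'⟩ := exists_lt_of_csInf_lt (levySet_nonempty G H)
    (show sInf (levySet G H) < levyDist G H + r / 2 by
      change levyDist G H < _
      linarith)
  have := csInf_le (levySet_bddBelow F H) (levySet_add hε hδ)
  change levyDist F H ≤ _ at this
  linarith

theorem le_of_levyDist_eq_zero {F G : UnitDist} (h : levyDist F G = 0) (y : ℝ) :
    G.cdf y ≤ F.cdf y := by
  have hc := F.cdf_rightCont y
  rw [Metric.continuousWithinAt_iff] at hc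
  refine le_of_forall_pos_le_add fun r hr => ?_
  obtain ⟨d, hd, hc⟩ := hc (r / 2) (by linarith)
  obtain ⟨ε, hε, hε'⟩ := exists_lt_of_csInf_lt (levySet_nonempty F G)
    (show sInf (levySet F G) < min d (r / 2) by
      change levyDist F G < _
      rw [h]
      exact lt_min hd (by linarith))
  have h1 := lt_of_lt_of_le hε' (min_le_left _ _)
  have h2 := lt_of_lt_of_le hε' (min_le_right _ _)
  have h3 := (hε.2 y).2
  have h4 := hc (x := y + ε) (Set.mem_Ici.2 (by linarith [hε.1])) (by
    rw [Real.dist_eq, add_sub_cancel_left, abs_of_pos hε.1]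
    exact h1)
  rw [Real.dist_eq] at h4
  have h5 := (abs_lt.1 h4).2
  linarith

instance : MetricSpace UnitDist where
  dist := levyDist
  dist_self := levyDist_self
  dist_comm := levyDist_comm
  dist_triangle := levyDist_triangle
  eq_of_dist_eq_zero := fun {F G} h => ext_cdf fun y =>
    le_antisymm (le_of_levyDist_eq_zero ((levyDist_comm G F).trans h) y)
      (le_of_levyDist_eq_zero h y)

/-- The Borel σ-field of the Lévy metric. -/
instance : MeasurableSpace UnitDist := borel UnitDist

instance : BorelSpace UnitDist := ⟨rfl⟩

/-- The values of the distribution function with quantile function `q`. For `0 ≤ y < 1` this is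
`inf {τ ∈ [0, 1] : y < q τ}` (and `1` if there is no such `τ`), which for a nondecreasing `q` is
the same as `sup {τ ∈ [0, 1] : q τ ≤ y}`. -/
def quantileInv (q : ℝ → ℝ) (y : ℝ) : ℝ :=
  if y < 0 then 0 else if 1 ≤ y then 1 else sInf (insert 1 {τ | τ ∈ Set.Icc (0 : ℝ) 1 ∧ y < q τ})

theorem quantileInv_bddBelow (q : ℝ → ℝ) (y : ℝ) :
    BddBelow (insert 1 {τ | τ ∈ Set.Icc (0 : ℝ) 1 ∧ y < q τ}) :=
  ⟨0, by
    rintro τ (rfl | h)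
    · exact zero_le_one
    · exact h.1.1⟩

theorem quantileInv_nonneg (q : ℝ → ℝ) (y : ℝ) : 0 ≤ quantileInv q y := by
  unfold quantileInv
  split_ifs
  · exact le_rfl
  · exact zero_le_one
  · refine Real.sInf_nonneg ?_
    rintro τ (rfl | h)
    · exact zero_le_one
    · exact h.1.1

theorem quantileInv_le_one (q : ℝ → ℝ) (y : ℝ) : quantileInv q y ≤ 1 := by
  unfold quantileInv
  split_ifs
  · exact zero_le_one
  · exact le_rfl
  · exact csInf_le (quantileInv_bddBelow q y) (Set.mem_insert _ _)

theorem quantileInv_mono (q : ℝ → ℝ) : Monotone (quantileInv q) := by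
  intro y z hyz
  by_cases hy : y < 0
  · rw [show quantileInv q y = 0 by simp [quantileInv, hy]]
    exact quantileInv_nonneg q z
  by_cases hz : 1 ≤ z
  · rw [show quantileInv q z = 1 by
      have : ¬ z < 0 := by linarith
      simp [quantileInv, this, hz]]
    exact quantileInv_le_one q y
  have hz0 : ¬ z < 0 := by linarith
  have hy1 : ¬ 1 ≤ y := by linarith
  simp only [quantileInv, hy, hz, hz0, hy1, if_false]
  refine csInf_le_csInf (quantileInv_bddBelow q y) ⟨1, Set.mem_insert _ _⟩ ?_
  rintro τ (rfl | h)
  · exact Set.mem_insert _ _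
  · exact Set.mem_insert_of_mem _ ⟨h.1, lt_of_le_of_lt hyz h.2⟩

theorem quantileInv_rightCont (q : ℝ → ℝ) (y : ℝ) :
    ContinuousWithinAt (quantileInv q) (Set.Ici y) y := by
  rw [Metric.continuousWithinAt_iff]
  intro r hr
  suffices h : ∃ d > 0, ∀ z, y ≤ z → z < y + d → quantileInv q z < quantileInv q y + r by
    obtain ⟨d, hd, h⟩ := h
    refine ⟨d, hd, fun z hz hzd => ?_⟩
    have hyz : y ≤ z := hz
    rw [Real.dist_eq, abs_of_nonneg (sub_nonneg.2 hyz)] at hzd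
    rw [Real.dist_eq, abs_of_nonneg (sub_nonneg.2 (quantileInv_mono q hyz))]
    linarith [h z hyz (by linarith)]
  by_cases hy : y < 0
  · refine ⟨-y, by linarith, fun z _ hz => ?_⟩
    have hz0 : z < 0 := by linarith
    simp only [quantileInv, hy, hz0, if_true]
    linarith
  by_cases hy1 : 1 ≤ y
  · refine ⟨1, one_pos, fun z _ _ => ?_⟩
    have e : quantileInv q y = 1 := by simp [quantileInv, hy, hy1]
    linarith [quantileInv_le_one q z]
  have e : quantileInv q y = sInf (insert 1 {τ | τ ∈ Set.Icc (0 : ℝ) 1 ∧ y < q τ}) := by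
    simp only [quantileInv, hy, hy1, if_false]
  obtain ⟨τ, hτ, hτr⟩ := exists_lt_of_csInf_lt
    (⟨1, Set.mem_insert _ _⟩ : (insert 1 {τ | τ ∈ Set.Icc (0 : ℝ) 1 ∧ y < q τ}).Nonempty)
    (show _ < quantileInv q y + r by
      rw [← e]
      linarith)
  rcases hτ with rfl | hτ
  · exact ⟨1, one_pos, fun z _ _ => by linarith [quantileInv_le_one q z]⟩
  · push Not at hy hy1
    refine ⟨min (q τ - y) (1 - y), lt_min (by linarith [hτ.2]) (by linarith), fun z hyz hz => ?_⟩
    have h1 : z < q τ := by linarith [min_le_left (q τ - y) (1 - y)]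
    have h2 : z < 1 := by linarith [min_le_right (q τ - y) (1 - y)]
    have h3 : ¬ z < 0 := by linarith
    have e2 : quantileInv q z = sInf (insert 1 {τ | τ ∈ Set.Icc (0 : ℝ) 1 ∧ z < q τ}) := by
      simp only [quantileInv, h3, not_le.2 h2, if_false]
    rw [e2]
    exact lt_of_le_of_lt (csInf_le (quantileInv_bddBelow q z)
      (Set.mem_insert_of_mem _ ⟨hτ.1, h1⟩)) hτr

/-- The distribution on `[0, 1]` induced by a quantile function `q`. -/
def ofQuantile (q : ℝ → ℝ) : UnitDist where
  toFun := quantileInv q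
  mono' := quantileInv_mono q
  right_continuous' := quantileInv_rightCont q
  eq_zero_of_neg := fun y hy => by simp [quantileInv, hy]
  eq_one_of_one_le := fun y hy => by
    have : ¬ y < 0 := by linarith
    simp [quantileInv, this, hy]

/-- The distribution function `F` induced by a strictly increasing quantile function `q` with
`q 0 = 0` and `q 1 = 1` satisfies `F (q τ) = τ`. -/
theorem ofQuantile_cdf_apply {q : ℝ → ℝ} (hq : StrictMonoOn q (Set.Icc 0 1)) (h0 : q 0 = 0)
    (h1 : q 1 = 1) {τ : ℝ} (hτ : τ ∈ Set.Ioo (0 : ℝ) 1) : (ofQuantile q).cdf (q τ) = τ := by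
  have m0 : (0 : ℝ) ∈ Set.Icc (0 : ℝ) 1 := ⟨le_rfl, zero_le_one⟩
  have m1 : (1 : ℝ) ∈ Set.Icc (0 : ℝ) 1 := ⟨zero_le_one, le_rfl⟩
  have mτ : τ ∈ Set.Icc (0 : ℝ) 1 := ⟨hτ.1.le, hτ.2.le⟩
  have a : 0 < q τ := by
    have := hq m0 mτ hτ.1
    rwa [h0] at this
  have b : q τ < 1 := by
    have := hq mτ m1 hτ.2
    rwa [h1] at this
  change quantileInv q (q τ) = τ
  simp only [quantileInv, not_lt.2 a.le, not_le.2 b, if_false]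
  refine le_antisymm (le_of_forall_gt_imp_ge_of_dense fun σ hσ => ?_)
    (le_csInf ⟨1, Set.mem_insert _ _⟩ ?_)
  · rcases le_or_gt 1 σ with h | h
    · exact (csInf_le (quantileInv_bddBelow q _) (Set.mem_insert _ _)).trans h
    · have mσ : σ ∈ Set.Icc (0 : ℝ) 1 := ⟨by linarith [hτ.1], h.le⟩
      exact csInf_le (quantileInv_bddBelow q _)
        (Set.mem_insert_of_mem _ ⟨mσ, hq mτ mσ hσ⟩)
  · rintro σ (rfl | h)
    · exact hτ.2.le
    · exact ((hq.lt_iff_lt mτ h.1).1 h.2).le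

end UnitDist

/-! ## Pyramid structures and finite quantile pyramids -/

/-- The quantile levels of a general pyramid: `levels m` is the finite set of quantile levels
`τ₁* < ⋯ < τ_T*` in `(0, 1)` that have been specified once `m` levels of the pyramid are built.
No quantile is specified at level `0`; specified levels are kept; at each step any finite number
of new levels (possibly none) may be placed in each band between two neighbouring old ones. -/
structure Scheme where
  levels : ℕ → Finset ℝ
  levels_zero : levels 0 = ∅
  levels_subset : ∀ m, levels m ⊆ levels (m + 1)
  levels_mem : ∀ m, ∀ τ ∈ levels m, τ ∈ Set.Ioo (0 : ℝ) 1

namespace Scheme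

/-- The specified quantile levels together with `τ₀* = 0` and `τ_{T+1}* = 1`. -/
def nodes (𝒯 : Scheme) (m : ℕ) : Finset ℝ := insert 0 (insert 1 (𝒯.levels m))

/-- `(a, b)` is a band of the `m`-level pyramid: `a < b` are neighbouring nodes. -/
def IsBand (𝒯 : Scheme) (m : ℕ) (a b : ℝ) : Prop :=
  a ∈ 𝒯.nodes m ∧ b ∈ 𝒯.nodes m ∧ a < b ∧ ∀ c ∈ 𝒯.nodes m, c ≤ a ∨ b ≤ c

/-- The largest node below `τ`. -/
def lower (𝒯 : Scheme) (m : ℕ) (τ : ℝ) : ℝ := sSup {s | s ∈ 𝒯.nodes m ∧ s < τ}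

/-- The smallest node above `τ`. -/
def upper (𝒯 : Scheme) (m : ℕ) (τ : ℝ) : ℝ := sInf {s | s ∈ 𝒯.nodes m ∧ τ < s}

/-- The weights of the pyramid. If the band `(a, b)` of the `m`-level pyramid receives `K ≥ 1` new
quantile levels `a = τ_{ε0} < τ_{ε1} < ⋯ < τ_{εK} < τ_{ε(K+1)} = b` at level `m + 1`, then
`v (m + 1) τ_{εk}`, `k = 1, …, K + 1`, is the number `V_{εk}`, that is, a weight is labelled by the
level at which it is used and by the right endpoint of its sub-band. The weights
`(V_{ε1}, …, V_{ε(K+1)})` have to lie in the interior of the simplex. -/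
def IsWeight (𝒯 : Scheme) (v : ℕ → ℝ → ℝ) : Prop :=
  ∀ m a b, 𝒯.IsBand m a b → (∃ τ ∈ 𝒯.levels (m + 1), a < τ ∧ τ < b) →
    (∀ s ∈ 𝒯.nodes (m + 1), a < s → s ≤ b → 0 < v (m + 1) s ∧ v (m + 1) s < 1) ∧
    ∑ s ∈ 𝒯.nodes (m + 1) with a < s ∧ s ≤ b, v (m + 1) s = 1

/-- The quantiles at the nodes of the `m`-level pyramid. Level `0` has `Q(0) = 0` and `Q(1) = 1`.
At level `m + 1`, old quantiles are inherited, and a new quantile in the band `(a, b)` is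
`Q_{εk} = Q_{ε0} (1 - ∑_{j ≤ k} V_{εj}) + Q_{ε(K+1)} ∑_{j ≤ k} V_{εj}`. -/
def nodeQuantile (𝒯 : Scheme) (v : ℕ → ℝ → ℝ) : ℕ → ℝ → ℝ
  | 0, τ => τ
  | m + 1, τ =>
    if τ ∈ 𝒯.nodes m then nodeQuantile 𝒯 v m τ
    else
      nodeQuantile 𝒯 v m (𝒯.lower m τ) *
          (1 - ∑ s ∈ 𝒯.nodes (m + 1) with 𝒯.lower m τ < s ∧ s ≤ τ, v (m + 1) s) +
        nodeQuantile 𝒯 v m (𝒯.upper m τ) *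
          ∑ s ∈ 𝒯.nodes (m + 1) with 𝒯.lower m τ < s ∧ s ≤ τ, v (m + 1) s

/-- The quantile function `Q^m : [0, 1] → [0, 1]` of the `m`-level finite quantile pyramid: linear
interpolation between the nodes. -/
def quantile (𝒯 : Scheme) (v : ℕ → ℝ → ℝ) (m : ℕ) (τ : ℝ) : ℝ :=
  if τ ∈ 𝒯.nodes m then 𝒯.nodeQuantile v m τ
  else
    𝒯.nodeQuantile v m (𝒯.lower m τ) +
      (𝒯.nodeQuantile v m (𝒯.upper m τ) - 𝒯.nodeQuantile v m (𝒯.lower m τ)) *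
        (τ - 𝒯.lower m τ) / (𝒯.upper m τ - 𝒯.lower m τ)

end Scheme

/-! ## Finite dependent quantile pyramids and their laws -/

variable {𝒳 Ω : Type*}

/-- `Q_x^m(τ)`: the process of finite dependent quantile pyramids with `m` levels driven by the
processes `V m x s`, `x ∈ 𝒳`. -/
def fdqpQuantile (𝒯 : Scheme) (V : ℕ → 𝒳 → ℝ → Ω → ℝ) (m : ℕ) (x : 𝒳) (ω : Ω) : ℝ → ℝ :=
  𝒯.quantile (fun k s => V k x s ω) m

/-- `F_x^m`: the conditional distributions induced by the `m`-level pyramids. -/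
def fdqp (𝒯 : Scheme) (V : ℕ → 𝒳 → ℝ → Ω → ℝ) (m : ℕ) (x : 𝒳) (ω : Ω) : UnitDist :=
  UnitDist.ofQuantile (fdqpQuantile 𝒯 V m x ω)

/-- `μ_m` on `D_S`: the joint law of the `m`-level pyramids at the covariate values in `S`. -/
def fdqpLaw [MeasurableSpace Ω] (P : Measure Ω) (𝒯 : Scheme) (V : ℕ → 𝒳 → ℝ → Ω → ℝ) (m : ℕ)
    (S : Finset 𝒳) : Measure (S → UnitDist) :=
  P.map fun ω (x : S) => fdqp 𝒯 V m x ω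

/-- The Prokhorov metric on laws on `D_S`, where `D_S = (S → D)` carries the supremum Lévy metric
`d_{L_u}(F, G) = sup_{x ∈ S} d_L(F_x, G_x)` (the distance of a finite product in Mathlib). -/
def jointProkhorov (S : Finset 𝒳) (μ ν : Measure (S → UnitDist)) : ℝ := levyProkhorovDist μ ν

/-- The supremum over `x ∈ S` of the Prokhorov distances of the laws at `x`. -/
def supProkhorov (S : Finset 𝒳) (μ ν : Measure (S → UnitDist)) : ℝ :=
  ⨆ x : S, levyProkhorovDist (μ.map fun F => F x) (ν.map fun F => F x)

end QuantilePyramid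

end

open MeasureTheory Filter Topology

noncomputable section

namespace QuantilePyramid

namespace UnitDist

/-! ### Separability and measurability for the Lévy metric -/

/-! Old nodes keep their quantiles, so the value at a specified level is final from the level of the
pyramid at which it is specified. Let the limit be the distribution with exactly these quantiles
(`limitPyramid`). If two quantile functions agree on a set of levels that meets every interval of
length more than ε, and neither exceeds its value at such a level before that level, then their
distribution functions differ by at most ε everywhere (`dist_ofQuantile_le`). Density supplies such
a set of nodes for all m ≥ M (`exists_forall_exists_node`), and M depends on ε and the scheme alone,
not on ω or x. The weights matter only through the monotonicity they give
(`monotoneOn_nodeQuantile`), so their joint law is irrelevant.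

All pyramids and the limit live on one probability space, so an almost sure bound on their distance
bounds the Prokhorov distance of their laws (`levyProkhorovDist_map_le`). Taking the law of the
limit as μ^S makes consistency and the existence of the process immediate; uniqueness is uniqueness
of Prokhorov limits. What remains is measurability: the Lévy metric is separable and its balls are
described by countably many values of the distribution function. -/

theorem dist_le_of_mem_levySet {F G : UnitDist} {ε : ℝ} (h : ε ∈ levySet F G) : dist F G ≤ ε :=
  csInf_le (levySet_bddBelow F G) h

theorem dist_le_of_abs_cdf_sub_le {F G : UnitDist} {ε : ℝ} (hε : 0 < ε)
    (h : ∀ y, |F.cdf y - G.cdf y| ≤ ε) : dist F G ≤ ε := by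
  refine dist_le_of_mem_levySet ⟨hε, fun y => ?_⟩
  have h1 := abs_le.1 (h y)
  have h2 := F.cdf_mono (show y - ε ≤ y by linarith)
  have h3 := F.cdf_mono (show y ≤ y + ε by linarith)
  constructor <;> linarith

/-- If the values of `F` do not exceed those of `G` by more than `1 / n` on the grid of mesh
`1 / n`, then `F (y - ε) - ε ≤ G y` for `ε ≥ 1 / n`. -/
theorem cdf_sub_le_of_grid {F G : UnitDist} {n : ℕ} (hn : 0 < n)
    (h : ∀ i : Fin (n + 1), F.cdf (i / n) ≤ G.cdf (i / n) + 1 / n) {ε : ℝ} (hε : 1 / (n : ℝ) ≤ ε)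
    (y : ℝ) : F.cdf (y - ε) - ε ≤ G.cdf y := by
  have hn' : (0 : ℝ) < n := by exact_mod_cast hn
  have hnε : 0 < 1 / (n : ℝ) := by positivity
  rcases lt_or_ge y 0 with hy | hy
  · have : F.cdf (y - ε) = 0 := F.eq_zero_of_neg _ (by linarith)
    linarith [G.cdf_nonneg y]
  rcases le_or_gt 1 y with hy1 | hy1
  · have : G.cdf y = 1 := G.eq_one_of_one_le _ hy1
    linarith [F.cdf_le_one (y - ε)]
  have hf1 := Nat.floor_le (a := y * n) (by positivity)
  have hf2 := Nat.lt_floor_add_one (y * n)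
  have hlt : ⌊y * n⌋₊ < n + 1 := by
    have : (⌊y * n⌋₊ : ℝ) < n := by nlinarith
    have : ⌊y * n⌋₊ < n := by exact_mod_cast this
    omega
  have hi := h ⟨_, hlt⟩
  simp only at hi
  have e1 : (⌊y * n⌋₊ : ℝ) / n ≤ y := (div_le_iff₀ hn').2 hf1
  have e2 : y - ε ≤ (⌊y * n⌋₊ : ℝ) / n := by
    have : y < (⌊y * n⌋₊ + 1 : ℝ) / n := (lt_div_iff₀ hn').2 hf2
    rw [add_div] at this
    linarith
  linarith [F.cdf_mono e2, G.cdf_mono e1]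

/-- Rounding the values on a grid of mesh `1 / N` down to multiples of `1 / N` maps into a countable
set, and distributions with the same image are within ε. -/
instance : SecondCountableTopology UnitDist := by
  refine Metric.secondCountable_of_countable_discretization fun ε hε => ?_
  obtain ⟨n, hn⟩ := exists_nat_one_div_lt hε
  let N := n + 1
  have hN : (0 : ℝ) < N := by positivity
  have hNε : 1 / (N : ℝ) ≤ ε := by
    simp only [N]
    push_cast
    exact hn.le
  refine ⟨Fin (N + 1) → ℤ, inferInstance, fun F i => ⌊F.cdf (i / N) * N⌋, fun F G hFG => ?_⟩
  have key : ∀ i : Fin (N + 1), |F.cdf (i / N) - G.cdf (i / N)| < 1 / N := fun i => by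
    have := Int.abs_sub_lt_one_of_floor_eq_floor (congrFun hFG i)
    rwa [← sub_mul, abs_mul, abs_of_pos hN, ← lt_div_iff₀ hN] at this
  have h1 : ∀ y, F.cdf (y - ε) - ε ≤ G.cdf y := cdf_sub_le_of_grid (n := N) (Nat.succ_pos n)
    (fun i => by linarith [(abs_lt.1 (key i)).2]) hNε
  have h2 : ∀ y, G.cdf (y - ε) - ε ≤ F.cdf y := cdf_sub_le_of_grid (n := N) (Nat.succ_pos n)
    (fun i => by linarith [(abs_lt.1 (key i)).1]) hNε
  refine dist_le_of_mem_levySet ⟨hε, fun y => ⟨h1 y, ?_⟩⟩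
  have := h2 (y + ε)
  rw [add_sub_cancel_right] at this
  linarith

/-- Two right-continuous functions are comparable as soon as they are so at the rationals. -/
theorem le_of_forall_rat_le {f g : ℝ → ℝ} (hf : ∀ y, ContinuousWithinAt f (Set.Ici y) y)
    (hg : ∀ y, ContinuousWithinAt g (Set.Ici y) y) (h : ∀ q : ℚ, f q ≤ g q) (y : ℝ) :
    f y ≤ g y := by
  by_contra! hlt
  have h1 : ∀ᶠ z in 𝓝[≥] y, g z < f z := (hg y).eventually_lt (hf y) hlt
  obtain ⟨u, hu, hsub⟩ := mem_nhdsGE_iff_exists_Ico_subset.1 h1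
  obtain ⟨q, hq1, hq2⟩ := exists_rat_btwn (show y < u from hu)
  exact absurd (h q) (not_le.2 (hsub ⟨hq1.le, hq2⟩))

theorem cdf_comp_add_rightCont (F : UnitDist) (a y : ℝ) :
    ContinuousWithinAt (fun z => F.cdf (z + a)) (Set.Ici y) y :=
  ContinuousWithinAt.comp (f := fun z => z + a) (F.cdf_rightCont (y + a)) (by fun_prop) fun z hz => by
    have : y ≤ z := hz
    simpa using this

/-- Both sides of each inequality are right-continuous in the argument, so rational arguments
suffice and the condition becomes a countable intersection. -/
theorem mem_levySet_iff_rat {F G : UnitDist} {ε : ℝ} : ε ∈ levySet F G ↔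
    0 < ε ∧ ∀ q : ℚ, F.cdf (q - ε) - ε ≤ G.cdf q ∧ G.cdf q ≤ F.cdf (q + ε) + ε := by
  refine ⟨fun h => ⟨h.1, fun q => h.2 q⟩, fun h => ⟨h.1, fun y => ⟨?_, ?_⟩⟩⟩
  · exact le_of_forall_rat_le (f := fun y => F.cdf (y - ε) - ε)
      (fun y => (F.cdf_comp_add_rightCont (-ε) y).sub continuousWithinAt_const)
      G.cdf_rightCont (fun q => (h.2 q).1) y
  · exact le_of_forall_rat_le (g := fun y => F.cdf (y + ε) + ε) G.cdf_rightCont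
      (fun y => (F.cdf_comp_add_rightCont ε y).add continuousWithinAt_const)
      (fun q => (h.2 q).2) y

/-- The admissible set is closed upwards, so a rational can be chosen above any admissible number.
-/
theorem dist_lt_iff_exists_rat {F G : UnitDist} {r : ℝ} :
    dist F G < r ↔ ∃ q : ℚ, (q : ℝ) < r ∧ (q : ℝ) ∈ levySet F G := by
  constructor
  · intro h
    obtain ⟨ε, hε, hεr⟩ := exists_lt_of_csInf_lt (levySet_nonempty F G) h
    obtain ⟨q, hq1, hq2⟩ := exists_rat_btwn hεr
    refine ⟨q, hq2, hε.1.trans hq1, fun y => ⟨?_, ?_⟩⟩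
    · linarith [(hε.2 y).1, F.cdf_mono (show y - q ≤ y - ε by linarith)]
    · linarith [(hε.2 y).2, F.cdf_mono (show y + ε ≤ y + q by linarith)]
  · rintro ⟨q, hq, h⟩
    exact (dist_le_of_mem_levySet h).trans_lt hq

/-- A map into the space of distributions is measurable if the values of the distribution
functions are. -/
theorem measurable_of_cdf {Ω : Type*} [MeasurableSpace Ω] {f : Ω → UnitDist}
    (hf : ∀ y, Measurable fun ω => (f ω).cdf y) : Measurable f := by
  have hball : ∀ G r, MeasurableSet {ω | dist (f ω) G < r} := fun G r => by
    simp only [dist_lt_iff_exists_rat, mem_levySet_iff_rat, Set.ofPred_exists, Set.ofPred_and,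
      Set.ofPred_forall]
    refine MeasurableSet.iUnion fun q => (MeasurableSet.const _).inter
      ((MeasurableSet.const _).inter (MeasurableSet.iInter fun y => ?_))
    exact (measurableSet_le ((hf _).sub_const _) measurable_const).inter
      (measurableSet_le measurable_const ((hf _).add_const _))
  refine measurable_of_isOpen fun U hU => ?_
  rcases isEmpty_or_nonempty UnitDist with he | he
  · have : IsEmpty Ω := ⟨fun ω => he.elim (f ω)⟩
    exact Subsingleton.measurableSet
  -- By separability an open set is a countable union of balls with centres in a dense sequence and
  -- rational radii.
  have hU' : f ⁻¹' U = ⋃ (n : ℕ) (q : ℚ)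
      (_ : Metric.ball (TopologicalSpace.denseSeq UnitDist n) q ⊆ U),
      {ω | dist (f ω) (TopologicalSpace.denseSeq UnitDist n) < q} := by
    ext ω
    simp only [Set.mem_preimage, Set.mem_iUnion, Set.mem_ofPred_eq, exists_prop]
    constructor
    · intro h
      obtain ⟨ε, hε, hsub⟩ := Metric.isOpen_iff.1 hU _ h
      obtain ⟨q, hq1, hq2⟩ := exists_rat_btwn (half_pos hε)
      obtain ⟨n, hn⟩ := (TopologicalSpace.denseRange_denseSeq UnitDist).exists_dist_lt (f ω) hq1
      refine ⟨n, q, fun G hG => hsub ?_, hn⟩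
      rw [Metric.mem_ball] at hG ⊢
      rw [dist_comm] at hn
      linarith [dist_triangle G (TopologicalSpace.denseSeq UnitDist n) (f ω)]
    · rintro ⟨n, q, hsub, h⟩
      exact hsub h
  rw [hU']
  exact MeasurableSet.iUnion fun n => MeasurableSet.iUnion fun q =>
    MeasurableSet.iUnion fun _ => hball _ _

/-! ### Distributions induced by quantile functions -/

theorem quantileInv_of_mem (q : ℝ → ℝ) {y : ℝ} (h0 : 0 ≤ y) (h1 : y < 1) :
    quantileInv q y = sInf (insert 1 {τ | τ ∈ Set.Icc (0 : ℝ) 1 ∧ y < q τ}) := by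
  simp only [quantileInv, not_lt.2 h0, not_le.2 h1, if_false]

/-- An infimum is below `r` exactly when some member is; the alternative `1 < r` comes from the
inserted point 1. -/
theorem quantileInv_lt_iff (q : ℝ → ℝ) {y : ℝ} (h0 : 0 ≤ y) (h1 : y < 1) {r : ℝ} :
    quantileInv q y < r ↔ 1 < r ∨ ∃ τ ∈ Set.Icc (0 : ℝ) 1, y < q τ ∧ τ < r := by
  rw [quantileInv_of_mem q h0 h1, csInf_lt_iff (quantileInv_bddBelow q y) ⟨1, Set.mem_insert _ _⟩]
  constructor
  · rintro ⟨τ, rfl | h, hτ⟩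
    · exact Or.inl hτ
    · exact Or.inr ⟨τ, h.1, h.2, hτ⟩
  · rintro (h | ⟨τ, hm, h, hτ⟩)
    · exact ⟨1, Set.mem_insert _ _, h⟩
    · exact ⟨τ, Set.mem_insert_of_mem _ ⟨hm, h⟩, hτ⟩

/-- A random distribution is measurable if its random quantile function is determined by its values
at countably many levels. -/
theorem measurable_ofQuantile {Ω : Type*} [MeasurableSpace Ω] {q : Ω → ℝ → ℝ} {C : Set ℝ}
    (hC : C.Countable) (hq : ∀ τ ∈ C, Measurable fun ω => q ω τ)
    (h : ∀ ω, ∀ y ≥ 0, ∀ r, ∀ τ ∈ Set.Icc (0 : ℝ) 1, y < q ω τ → τ < r →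
      ∃ σ ∈ C, σ ∈ Set.Icc (0 : ℝ) 1 ∧ y < q ω σ ∧ σ < r) :
    Measurable fun ω => ofQuantile (q ω) := by
  refine measurable_of_cdf fun y => ?_
  change Measurable fun ω => quantileInv (q ω) y
  rcases lt_or_ge y 0 with hy | hy
  · simp only [quantileInv, hy, if_true]
    exact measurable_const
  rcases le_or_gt 1 y with hy1 | hy1
  · simp only [quantileInv, not_lt.2 hy, hy1, if_true, if_false]
    exact measurable_const
  refine measurable_of_Iio fun r => ?_
  have : (fun ω => quantileInv (q ω) y) ⁻¹' Set.Iio r =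
      {_ω | 1 < r} ∪ ⋃ σ ∈ C, {ω | σ ∈ Set.Icc (0 : ℝ) 1 ∧ y < q ω σ ∧ σ < r} := by
    ext ω
    simp only [Set.mem_preimage, Set.mem_Iio, quantileInv_lt_iff _ hy hy1, Set.mem_union,
      Set.mem_ofPred_eq, Set.mem_iUnion, exists_prop]
    refine or_congr Iff.rfl ⟨?_, ?_⟩
    · rintro ⟨τ, hτ, h1, h2⟩
      exact h ω y hy r τ hτ h1 h2
    · rintro ⟨σ, -, h1, h2⟩
      exact ⟨σ, h1, h2⟩
  rw [this]
  refine (MeasurableSet.const _).union (MeasurableSet.biUnion hC fun σ hσ => ?_)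
  exact (MeasurableSet.const _).inter
    ((measurableSet_lt measurable_const (hq σ hσ)).inter (MeasurableSet.const _))

/-- No level below `τ` enters the infimum. Global monotonicity of `q` is deliberately not required,
since `limitQuantile` lacks it. -/
theorem le_quantileInv {q : ℝ → ℝ} {τ y : ℝ} (h0 : 0 ≤ y) (hτ : τ ≤ 1)
    (h : ∀ σ ∈ Set.Icc (0 : ℝ) 1, σ < τ → q σ ≤ y) : τ ≤ quantileInv q y := by
  rcases le_or_gt 1 y with hy1 | hy1
  · simpa only [quantileInv, not_lt.2 h0, hy1, if_true, if_false] using hτ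
  by_contra! hlt
  rcases (quantileInv_lt_iff q h0 hy1).1 hlt with h1 | ⟨σ, hm, h1, h2⟩
  · linarith
  · linarith [h σ hm h2]

theorem quantileInv_le {q : ℝ → ℝ} {τ y : ℝ} (hτ : τ ∈ Set.Icc (0 : ℝ) 1) (hy1 : y < 1)
    (h : y < q τ) : quantileInv q y ≤ τ := by
  rcases lt_or_ge y 0 with hy | hy
  · simpa only [quantileInv, hy, if_true] using hτ.1
  rw [quantileInv_of_mem q hy hy1]
  exact csInf_le (quantileInv_bddBelow q y) (Set.mem_insert_of_mem _ ⟨hτ, h⟩)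

/-- `N` is a set of levels at which `q` and `q'` agree and which hits all intervals in `[0, 1]` of
length more than `ε`. If `q'` does not exceed its value at a level of `N` before that level, then
the distribution function of `q'` is bounded below by that of `q` up to `ε`. -/
theorem quantileInv_le_add {q q' : ℝ → ℝ} {N : Set ℝ} {ε : ℝ} (hε : 0 ≤ ε)
    (hN : ∀ s t, 0 ≤ s → t ≤ 1 → s + ε < t → ∃ τ ∈ N, s < τ ∧ τ < t)
    (heq : ∀ τ ∈ N, q τ = q' τ)
    (hmono : ∀ τ ∈ N, ∀ σ ∈ Set.Icc (0 : ℝ) 1, σ < τ → q' σ ≤ q' τ) (y : ℝ) :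
    quantileInv q y ≤ quantileInv q' y + ε := by
  rcases lt_or_ge y 0 with hy | hy
  · simp only [quantileInv, hy, if_true, zero_add]
    exact hε
  rcases le_or_gt 1 y with hy1 | hy1
  · simp only [quantileInv, not_lt.2 hy, hy1, if_true, if_false]
    linarith
  by_contra! hlt
  obtain ⟨τ, hτ, h1, h2⟩ := hN _ _ (quantileInv_nonneg q' y) (quantileInv_le_one q y) hlt
  have h0 := quantileInv_nonneg q' y
  have h1' := quantileInv_le_one q y
  -- The level `τ` lies strictly between the two values. If `y < q τ`, it bounds the larger one from
  -- above; otherwise `q'` stays at most `y` before `τ`, and `τ` bounds the smaller one from below.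
  rcases lt_or_ge y (q τ) with h | h
  · exact absurd (quantileInv_le ⟨by linarith, by linarith⟩ hy1 h) (not_le.2 h2)
  · refine absurd (le_quantileInv hy (by linarith) fun σ hσ hστ => ?_) (not_le.2 h1)
    exact (hmono τ hτ σ hσ hστ).trans (heq τ hτ ▸ h)

theorem dist_ofQuantile_le {q q' : ℝ → ℝ} {N : Set ℝ} {ε : ℝ} (hε : 0 < ε)
    (hN : ∀ s t, 0 ≤ s → t ≤ 1 → s + ε < t → ∃ τ ∈ N, s < τ ∧ τ < t)
    (heq : ∀ τ ∈ N, q τ = q' τ)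
    (hq : ∀ τ ∈ N, ∀ σ ∈ Set.Icc (0 : ℝ) 1, σ < τ → q σ ≤ q τ)
    (hq' : ∀ τ ∈ N, ∀ σ ∈ Set.Icc (0 : ℝ) 1, σ < τ → q' σ ≤ q' τ) :
    dist (ofQuantile q) (ofQuantile q') ≤ ε := by
  refine dist_le_of_abs_cdf_sub_le hε fun y => ?_
  change |quantileInv q y - quantileInv q' y| ≤ ε
  have h1 := quantileInv_le_add hε.le hN heq hq' y
  have h2 := quantileInv_le_add hε.le hN (fun τ hτ => (heq τ hτ).symm) hq y
  exact abs_le.2 ⟨by linarith, by linarith⟩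

end UnitDist

/-! ### Prokhorov distances of nearby random variables -/

/-- The pair is a coupling: almost surely, if `f ω` lies in a set then `g ω` lies in its
δ-thickening for every δ > ε. The additive slack of the Prokhorov metric is not needed. -/
theorem levyProkhorovDist_map_le {Ω E : Type*} [MeasurableSpace Ω] {P : Measure Ω}
    [IsProbabilityMeasure P] [PseudoMetricSpace E] [MeasurableSpace E] [OpensMeasurableSpace E]
    {f g : Ω → E} (hf : Measurable f) (hg : Measurable g) {ε : ℝ} (hε : 0 ≤ ε)
    (h : ∀ᵐ ω ∂P, dist (f ω) (g ω) ≤ ε) :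
    levyProkhorovDist (P.map f) (P.map g) ≤ ε := by
  have := Measure.isProbabilityMeasure_map (μ := P) hf.aemeasurable
  have := Measure.isProbabilityMeasure_map (μ := P) hg.aemeasurable
  refine levyProkhorovDist_le_of_forall_le _ _ hε fun δ B hδ hB => ?_
  rw [Measure.map_apply hf hB, Measure.map_apply hg Metric.isOpen_thickening.measurableSet]
  refine le_trans (measure_mono_ae ?_) le_self_add
  filter_upwards [h] with ω hω hωB
  refine Metric.mem_thickening_iff.2 ⟨f ω, hωB, ?_⟩
  rw [dist_comm]
  exact hω.trans_lt hδ

theorem levyProkhorovDist_nonneg {E : Type*} [PseudoEMetricSpace E] [MeasurableSpace E]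
    (μ ν : Measure E) : 0 ≤ levyProkhorovDist μ ν := ENNReal.toReal_nonneg

/-- Limits with respect to the Prokhorov metric are unique. -/
theorem eq_of_tendsto_levyProkhorovDist {E : Type*} [PseudoEMetricSpace E] [MeasurableSpace E]
    [BorelSpace E] {κ : ℕ → Measure E} {μ ν : Measure E} [∀ n, IsFiniteMeasure (κ n)]
    [IsFiniteMeasure μ] [IsFiniteMeasure ν]
    (hμ : Tendsto (fun n => levyProkhorovDist (κ n) μ) atTop (𝓝 0))
    (hν : Tendsto (fun n => levyProkhorovDist (κ n) ν) atTop (𝓝 0)) : ν = μ := by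
  have h0 : levyProkhorovDist ν μ ≤ 0 := by
    refine ge_of_tendsto' (x := atTop) (by simpa using hν.add hμ) fun n => ?_
    rw [levyProkhorovDist_comm (κ n) ν]
    exact levyProkhorovDist_triangle ν (κ n) μ
  -- A zero real distance could also come from an infinite extended one; finiteness of the measures
  -- rules this out.
  have h1 : levyProkhorovEDist ν μ = 0 := by
    have := h0.antisymm (levyProkhorovDist_nonneg ν μ)
    exact ((ENNReal.toReal_eq_zero_iff _).1 this).resolve_right (levyProkhorovEDist_ne_top ν μ)
  refine Measure.ext_of_generateFrom_of_iUnion {s : Set E | IsClosed s} (fun _ => Set.univ)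
    (BorelSpace.measurable_eq.trans borel_eq_generateFrom_isClosed) isPiSystem_isClosed
    (Set.iUnion_const _) (fun _ => isClosed_univ) (fun _ => measure_ne_top _ _) fun s hs => ?_
  exact measure_eq_measure_of_levyProkhorovEDist_eq_zero_of_isClosed h1 hs
    ⟨1, one_pos, measure_ne_top _ _⟩ ⟨1, one_pos, measure_ne_top _ _⟩

end QuantilePyramid

namespace QuantilePyramid

namespace Scheme

variable (𝒯 : Scheme)

/-! ### Nodes and bands -/

theorem mem_nodes {m : ℕ} {τ : ℝ} : τ ∈ 𝒯.nodes m ↔ τ = 0 ∨ τ = 1 ∨ τ ∈ 𝒯.levels m := by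
  simp [nodes]

theorem zero_mem_nodes (m : ℕ) : (0 : ℝ) ∈ 𝒯.nodes m := 𝒯.mem_nodes.2 (Or.inl rfl)

theorem one_mem_nodes (m : ℕ) : (1 : ℝ) ∈ 𝒯.nodes m := 𝒯.mem_nodes.2 (Or.inr (Or.inl rfl))

theorem levels_subset_nodes (m : ℕ) : 𝒯.levels m ⊆ 𝒯.nodes m := fun _ h =>
  𝒯.mem_nodes.2 (Or.inr (Or.inr h))

theorem levels_mono : Monotone 𝒯.levels := monotone_nat_of_le_succ 𝒯.levels_subset

theorem nodes_mono : Monotone 𝒯.nodes := fun _ _ h =>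
  Finset.insert_subset_insert _ (Finset.insert_subset_insert _ (𝒯.levels_mono h))

theorem nodes_mem_Icc {m : ℕ} {τ : ℝ} (h : τ ∈ 𝒯.nodes m) : τ ∈ Set.Icc (0 : ℝ) 1 := by
  rcases 𝒯.mem_nodes.1 h with rfl | rfl | h
  · exact ⟨le_rfl, zero_le_one⟩
  · exact ⟨zero_le_one, le_rfl⟩
  · exact Set.Ioo_subset_Icc_self (𝒯.levels_mem m τ h)

variable {𝒯} {m : ℕ} {τ : ℝ}

theorem lower_spec (h : 0 < τ) :
    𝒯.lower m τ ∈ 𝒯.nodes m ∧ 𝒯.lower m τ < τ ∧ ∀ c ∈ 𝒯.nodes m, c < τ → c ≤ 𝒯.lower m τ := by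
  have hf : {s | s ∈ 𝒯.nodes m ∧ s < τ}.Finite :=
    (𝒯.nodes m).finite_toSet.subset fun s hs => hs.1
  have hm : 𝒯.lower m τ ∈ {s | s ∈ 𝒯.nodes m ∧ s < τ} :=
    Set.Nonempty.csSup_mem ⟨0, 𝒯.zero_mem_nodes m, h⟩ hf
  exact ⟨hm.1, hm.2, fun c hc hcτ => le_csSup hf.bddAbove ⟨hc, hcτ⟩⟩

theorem upper_spec (h : τ < 1) :
    𝒯.upper m τ ∈ 𝒯.nodes m ∧ τ < 𝒯.upper m τ ∧ ∀ c ∈ 𝒯.nodes m, τ < c → 𝒯.upper m τ ≤ c := by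
  have hf : {s | s ∈ 𝒯.nodes m ∧ τ < s}.Finite :=
    (𝒯.nodes m).finite_toSet.subset fun s hs => hs.1
  have hm : 𝒯.upper m τ ∈ {s | s ∈ 𝒯.nodes m ∧ τ < s} :=
    Set.Nonempty.csInf_mem ⟨1, 𝒯.one_mem_nodes m, h⟩ hf
  exact ⟨hm.1, hm.2, fun c hc hcτ => csInf_le hf.bddBelow ⟨hc, hcτ⟩⟩

theorem mem_Ioo_of_notMem_nodes (hτ : τ ∈ Set.Icc (0 : ℝ) 1) (h : τ ∉ 𝒯.nodes m) :
    τ ∈ Set.Ioo (0 : ℝ) 1 := by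
  refine ⟨lt_of_le_of_ne hτ.1 ?_, lt_of_le_of_ne hτ.2 ?_⟩
  · rintro rfl
    exact h (𝒯.zero_mem_nodes m)
  · rintro rfl
    exact h (𝒯.one_mem_nodes m)

theorem isBand_lower_upper (hτ : τ ∈ Set.Ioo (0 : ℝ) 1) (h : τ ∉ 𝒯.nodes m) :
    𝒯.IsBand m (𝒯.lower m τ) (𝒯.upper m τ) := by
  obtain ⟨h1, h2, h3⟩ := lower_spec (𝒯 := 𝒯) (m := m) hτ.1
  obtain ⟨k1, k2, k3⟩ := upper_spec (𝒯 := 𝒯) (m := m) hτ.2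
  refine ⟨h1, k1, h2.trans k2, fun c hc => ?_⟩
  rcases lt_trichotomy c τ with hcτ | rfl | hcτ
  · exact Or.inl (h3 c hc hcτ)
  · exact absurd hc h
  · exact Or.inr (k3 c hc hcτ)

/-! ### Quantiles at the nodes -/

theorem nodeQuantile_zero (v : ℕ → ℝ → ℝ) (m : ℕ) : 𝒯.nodeQuantile v m 0 = 0 := by
  induction m with
  | zero => rfl
  | succ m ih => simp only [nodeQuantile, 𝒯.zero_mem_nodes m, if_true, ih]

theorem nodeQuantile_one (v : ℕ → ℝ → ℝ) (m : ℕ) : 𝒯.nodeQuantile v m 1 = 1 := by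
  induction m with
  | zero => rfl
  | succ m ih => simp only [nodeQuantile, 𝒯.one_mem_nodes m, if_true, ih]

theorem nodeQuantile_succ_of_mem (v : ℕ → ℝ → ℝ) (h : τ ∈ 𝒯.nodes m) :
    𝒯.nodeQuantile v (m + 1) τ = 𝒯.nodeQuantile v m τ := by
  simp only [nodeQuantile, h, if_true]

theorem nodeQuantile_of_le (v : ℕ → ℝ → ℝ) {n : ℕ} (hmn : m ≤ n) (h : τ ∈ 𝒯.nodes m) :
    𝒯.nodeQuantile v n τ = 𝒯.nodeQuantile v m τ := by
  induction n, hmn using Nat.le_induction with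
  | base => rfl
  | succ n hmn ih => rw [nodeQuantile_succ_of_mem v (𝒯.nodes_mono hmn h), ih]

/-- The total weight of the sub-bands of the band of `τ` that lie below `τ`. -/
def partialWeight (𝒯 : Scheme) (v : ℕ → ℝ → ℝ) (m : ℕ) (τ : ℝ) : ℝ :=
  ∑ s ∈ 𝒯.nodes (m + 1) with 𝒯.lower m τ < s ∧ s ≤ τ, v (m + 1) s

/-- Written as lower end plus increment times weight, the quantile is visibly monotone in the
weight. -/
theorem nodeQuantile_succ_of_notMem (v : ℕ → ℝ → ℝ) (h : τ ∉ 𝒯.nodes m) :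
    𝒯.nodeQuantile v (m + 1) τ = 𝒯.nodeQuantile v m (𝒯.lower m τ) +
      (𝒯.nodeQuantile v m (𝒯.upper m τ) - 𝒯.nodeQuantile v m (𝒯.lower m τ)) *
        𝒯.partialWeight v m τ := by
  simp only [nodeQuantile, h, if_false, partialWeight]
  ring

section Weights

variable {v : ℕ → ℝ → ℝ} (hv : 𝒯.IsWeight v)
include hv

/-- The hypotheses place both levels in one band, so the larger partial sum only adds positive
weights. -/
theorem partialWeight_mono {σ : ℝ} (hσ : σ ∈ 𝒯.nodes (m + 1)) (hτ1 : τ < 1) (hσ0 : 0 < σ)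
    (hσm : σ ∉ 𝒯.nodes m) (hστ : σ ≤ τ) (hlow : 𝒯.lower m σ = 𝒯.lower m τ)
    (hup : τ < 𝒯.upper m σ) : 𝒯.partialWeight v m σ ≤ 𝒯.partialWeight v m τ := by
  have hσI : σ ∈ Set.Ioo (0 : ℝ) 1 := ⟨hσ0, by linarith⟩
  have hb := isBand_lower_upper hσI hσm
  have hσl : σ ∈ 𝒯.levels (m + 1) := by
    rcases 𝒯.mem_nodes.1 hσ with h | h | h
    · exact absurd h hσ0.ne'
    · exact absurd h hσI.2.ne
    · exact h
  have hpos := (hv m _ _ hb ⟨σ, hσl, (lower_spec hσ0).2.1, (upper_spec hσI.2).2.1⟩).1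
  refine Finset.sum_le_sum_of_subset_of_nonneg (fun s hs => ?_) fun s hs _ => ?_
  · rw [Finset.mem_filter] at hs ⊢
    exact ⟨hs.1, hlow ▸ hs.2.1, hs.2.2.trans hστ⟩
  · rw [Finset.mem_filter, ← hlow] at hs
    exact (hpos s hs.1 hs.2.1 (hs.2.2.trans hup.le)).1.le

theorem partialWeight_mem_Icc (hτ : τ ∈ 𝒯.nodes (m + 1)) (hτm : τ ∉ 𝒯.nodes m) :
    𝒯.partialWeight v m τ ∈ Set.Icc (0 : ℝ) 1 := by
  have hτI := mem_Ioo_of_notMem_nodes (𝒯.nodes_mem_Icc hτ) hτm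
  have hb := isBand_lower_upper hτI hτm
  have hτl : τ ∈ 𝒯.levels (m + 1) := by
    rcases 𝒯.mem_nodes.1 hτ with h | h | h
    · exact absurd h hτI.1.ne'
    · exact absurd h hτI.2.ne
    · exact h
  have hup := (upper_spec (𝒯 := 𝒯) (m := m) hτI.2).2.1
  obtain ⟨hpos, hsum⟩ := hv m _ _ hb ⟨τ, hτl, (lower_spec hτI.1).2.1, hup⟩
  constructor
  · refine Finset.sum_nonneg fun s hs => ?_
    rw [Finset.mem_filter] at hs
    exact (hpos s hs.1 hs.2.1 (hs.2.2.trans hup.le)).1.le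
  · rw [← hsum]
    refine Finset.sum_le_sum_of_subset_of_nonneg (fun s hs => ?_) fun s hs _ => ?_
    · rw [Finset.mem_filter] at hs ⊢
      exact ⟨hs.1, hs.2.1, hs.2.2.trans hup.le⟩
    · rw [Finset.mem_filter] at hs
      exact (hpos s hs.1 hs.2.1 hs.2.2).1.le

/-- Specified quantiles are nondecreasing in the level. -/
theorem monotoneOn_nodeQuantile (m : ℕ) :
    MonotoneOn (𝒯.nodeQuantile v m) (𝒯.nodes m : Set ℝ) := by
  induction m with
  | zero => exact fun _ _ _ _ h => h
  | succ m ih =>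
    have hlow : ∀ τ ∈ 𝒯.nodes (m + 1), ∀ a ∈ 𝒯.nodes m, a ≤ τ →
        𝒯.nodeQuantile v m a ≤ 𝒯.nodeQuantile v (m + 1) τ := fun τ hτ a ha haτ => by
      by_cases hτm : τ ∈ 𝒯.nodes m
      · rw [nodeQuantile_succ_of_mem v hτm]
        exact ih ha hτm haτ
      have hτI := mem_Ioo_of_notMem_nodes (𝒯.nodes_mem_Icc hτ) hτm
      have hb := isBand_lower_upper hτI hτm
      have hne : a ≠ τ := by
        rintro rfl
        exact hτm ha
      have h1 := ih ha hb.1 ((lower_spec hτI.1).2.2 a ha (lt_of_le_of_ne haτ hne))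
      have h2 := ih hb.1 hb.2.1 hb.2.2.1.le
      rw [nodeQuantile_succ_of_notMem v hτm]
      have := mul_nonneg (sub_nonneg.2 h2) (partialWeight_mem_Icc hv hτ hτm).1
      linarith
    have hup : ∀ τ ∈ 𝒯.nodes (m + 1), ∀ b ∈ 𝒯.nodes m, τ ≤ b →
        𝒯.nodeQuantile v (m + 1) τ ≤ 𝒯.nodeQuantile v m b := fun τ hτ b hb' hτb => by
      by_cases hτm : τ ∈ 𝒯.nodes m
      · rw [nodeQuantile_succ_of_mem v hτm]
        exact ih hτm hb' hτb
      have hτI := mem_Ioo_of_notMem_nodes (𝒯.nodes_mem_Icc hτ) hτm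
      have hb := isBand_lower_upper hτI hτm
      have hne : τ ≠ b := by
        rintro rfl
        exact hτm hb'
      have h1 := ih hb.2.1 hb' ((upper_spec hτI.2).2.2 b hb' (lt_of_le_of_ne hτb hne))
      have h2 := ih hb.1 hb.2.1 hb.2.2.1.le
      rw [nodeQuantile_succ_of_notMem v hτm]
      have := mul_le_of_le_one_right (sub_nonneg.2 h2) (partialWeight_mem_Icc hv hτ hτm).2
      linarith
    intro σ hσ τ hτ hστ
    rw [Finset.mem_coe] at hσ hτ
    -- An old node between the two levels separates their quantiles. Without one, both levels are
    -- new and lie in the same band, where the partial weights decide.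
    by_cases hex : ∃ c ∈ 𝒯.nodes m, σ ≤ c ∧ c ≤ τ
    · obtain ⟨c, hc, h1, h2⟩ := hex
      exact (hup σ hσ c hc h1).trans (hlow τ hτ c hc h2)
    push Not at hex
    have hσm : σ ∉ 𝒯.nodes m := fun h => absurd hστ (not_le.2 (hex σ h le_rfl))
    have hτm : τ ∉ 𝒯.nodes m := fun h => absurd (hex τ h hστ) (lt_irrefl τ)
    have hσI := mem_Ioo_of_notMem_nodes (𝒯.nodes_mem_Icc hσ) hσm
    have hτI := mem_Ioo_of_notMem_nodes (𝒯.nodes_mem_Icc hτ) hτm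
    obtain ⟨a1, a2, a3⟩ := lower_spec (𝒯 := 𝒯) (m := m) hσI.1
    obtain ⟨b1, b2, b3⟩ := lower_spec (𝒯 := 𝒯) (m := m) hτI.1
    obtain ⟨c1, c2, c3⟩ := upper_spec (𝒯 := 𝒯) (m := m) hσI.2
    obtain ⟨d1, d2, d3⟩ := upper_spec (𝒯 := 𝒯) (m := m) hτI.2
    have el : 𝒯.lower m σ = 𝒯.lower m τ :=
      le_antisymm (b3 _ a1 (a2.trans_le hστ)) (a3 _ b1 (by
        by_contra! h
        exact absurd (hex _ b1 h) (not_lt.2 b2.le)))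
    have hτu : τ < 𝒯.upper m σ := hex _ c1 c2.le
    have eu : 𝒯.upper m σ = 𝒯.upper m τ :=
      le_antisymm (c3 _ d1 (hστ.trans_lt d2)) (d3 _ c1 hτu)
    have hw := partialWeight_mono hv hσ hτI.2 hσI.1 hσm hστ el hτu
    have h2 := ih a1 c1 (a2.trans c2).le
    rw [nodeQuantile_succ_of_notMem v hσm, nodeQuantile_succ_of_notMem v hτm, ← el, ← eu]
    have := mul_le_mul_of_nonneg_left hw (sub_nonneg.2 h2)
    linarith

theorem nodeQuantile_mem_Icc (hτ : τ ∈ 𝒯.nodes m) :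
    𝒯.nodeQuantile v m τ ∈ Set.Icc (0 : ℝ) 1 := by
  have h := 𝒯.nodes_mem_Icc hτ
  have h0 := monotoneOn_nodeQuantile hv m (𝒯.zero_mem_nodes m) hτ h.1
  have h1 := monotoneOn_nodeQuantile hv m hτ (𝒯.one_mem_nodes m) h.2
  rw [nodeQuantile_zero] at h0
  rw [nodeQuantile_one] at h1
  exact ⟨h0, h1⟩

/-- The interpolated value is at most the value at the right end of its band, which is a node not
beyond `τ`. -/
theorem quantile_le_of_lt_node (hτ : τ ∈ 𝒯.nodes m) {σ : ℝ} (hσ : σ ∈ Set.Icc (0 : ℝ) 1)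
    (hστ : σ < τ) : 𝒯.quantile v m σ ≤ 𝒯.quantile v m τ := by
  simp only [quantile, hτ, if_true]
  by_cases hσm : σ ∈ 𝒯.nodes m
  · simp only [hσm, if_true]
    exact monotoneOn_nodeQuantile hv m hσm hτ hστ.le
  simp only [hσm, if_false]
  have hσI := mem_Ioo_of_notMem_nodes hσ hσm
  obtain ⟨a1, a2, a3⟩ := lower_spec (𝒯 := 𝒯) (m := m) hσI.1
  obtain ⟨c1, c2, c3⟩ := upper_spec (𝒯 := 𝒯) (m := m) hσI.2
  have h1 := monotoneOn_nodeQuantile hv m c1 hτ (c3 τ hτ hστ)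
  have h2 := monotoneOn_nodeQuantile hv m a1 c1 (a2.trans c2).le
  have h3 : (σ - 𝒯.lower m σ) / (𝒯.upper m σ - 𝒯.lower m σ) ≤ 1 :=
    (div_le_one (by linarith)).2 (by linarith)
  rw [mul_div_assoc]
  have := mul_le_of_le_one_right (sub_nonneg.2 h2) h3
  linarith

end Weights

/-! ### The limiting quantiles -/

/-- The quantiles of the infinite pyramid at the specified levels, and `0` at all other levels. -/
def limitQuantile (𝒯 : Scheme) (v : ℕ → ℝ → ℝ) (τ : ℝ) : ℝ :=
  open Classical in
  if h : ∃ m, τ ∈ 𝒯.nodes m then 𝒯.nodeQuantile v (Nat.find h) τ else 0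

theorem limitQuantile_of_mem (v : ℕ → ℝ → ℝ) (h : τ ∈ 𝒯.nodes m) :
    𝒯.limitQuantile v τ = 𝒯.nodeQuantile v m τ := by
  classical
  have hex : ∃ m, τ ∈ 𝒯.nodes m := ⟨m, h⟩
  rw [limitQuantile, dif_pos hex]
  exact (nodeQuantile_of_le v (Nat.find_min' hex h) (Nat.find_spec hex)).symm

theorem quantile_eq_limitQuantile (v : ℕ → ℝ → ℝ) (h : τ ∈ 𝒯.nodes m) :
    𝒯.quantile v m τ = 𝒯.limitQuantile v τ := by
  rw [limitQuantile_of_mem v h, quantile, if_pos h]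

theorem limitQuantile_of_forall_notMem (v : ℕ → ℝ → ℝ) (h : ∀ m, τ ∉ 𝒯.nodes m) :
    𝒯.limitQuantile v τ = 0 :=
  dif_neg (not_exists.2 h)

/-- The default 0 at unspecified levels lies below every node value, so it does not disturb the
comparison. -/
theorem limitQuantile_le_of_lt_node {v : ℕ → ℝ → ℝ} (hv : 𝒯.IsWeight v) (hτ : τ ∈ 𝒯.nodes m)
    {σ : ℝ} (hστ : σ < τ) : 𝒯.limitQuantile v σ ≤ 𝒯.limitQuantile v τ := by
  by_cases h : ∃ n, σ ∈ 𝒯.nodes n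
  · obtain ⟨n, hn⟩ := h
    have h1 := 𝒯.nodes_mono (le_max_left n m) hn
    have h2 := 𝒯.nodes_mono (le_max_right n m) hτ
    rw [limitQuantile_of_mem v h1, limitQuantile_of_mem v h2]
    exact monotoneOn_nodeQuantile hv _ h1 h2 hστ.le
  · rw [limitQuantile_of_forall_notMem v (not_exists.1 h), limitQuantile_of_mem v hτ]
    exact (nodeQuantile_mem_Icc hv hτ).1

/-- If the specified levels are dense, then the nodes hit every interval of a given length once
sufficiently many levels of the pyramid are built. -/
theorem exists_forall_exists_node
    (h_dense : Set.Icc (0 : ℝ) 1 ⊆ closure (⋃ m, (𝒯.levels m : Set ℝ))) {ε : ℝ} (hε : 0 < ε) :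
    ∃ M, ∀ m ≥ M, ∀ s t : ℝ, 0 ≤ s → t ≤ 1 → s + ε < t → ∃ τ ∈ 𝒯.nodes m, s < τ ∧ τ < t := by
  -- With mesh below ε / 2, an interval longer than ε contains a whole grid cell.
  obtain ⟨n, hn⟩ := exists_nat_one_div_lt (half_pos hε)
  let N := n + 1
  have hN : (0 : ℝ) < N := by positivity
  have hNε : 1 / (N : ℝ) < ε / 2 := by
    simp only [N]
    push_cast
    exact hn
  have hex : ∀ i : Fin N, ∃ k, ∃ τ ∈ 𝒯.levels k, (i : ℝ) / N < τ ∧ τ < (i + 1 : ℝ) / N := by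
    intro i
    have hi : (i : ℝ) + 1 ≤ N := by exact_mod_cast i.2
    have hmem : ((i : ℝ) + 1 / 2) / N ∈ closure (⋃ m, (𝒯.levels m : Set ℝ)) := by
      refine h_dense ⟨by positivity, ?_⟩
      rw [div_le_one hN]
      linarith
    have hnhds : Set.Ioo ((i : ℝ) / N) ((i + 1 : ℝ) / N) ∈ 𝓝 (((i : ℝ) + 1 / 2) / N) :=
      Ioo_mem_nhds (div_lt_div_of_pos_right (by linarith) hN)
        (div_lt_div_of_pos_right (by linarith) hN)
    obtain ⟨τ, h1, h2⟩ := mem_closure_iff_nhds.1 hmem _ hnhds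
    obtain ⟨k, hk⟩ := Set.mem_iUnion.1 h2
    exact ⟨k, τ, hk, h1⟩
  choose k hk using hex
  refine ⟨Finset.univ.sup k, fun m hm s t hs ht hst => ?_⟩
  have hc1 : s * N < ⌊s * N⌋₊ + 1 := Nat.lt_floor_add_one _
  have hc2 : (⌊s * N⌋₊ : ℝ) ≤ s * N := Nat.floor_le (by positivity)
  have hNε' : 2 < ε * N := by
    rw [div_lt_iff₀ hN] at hNε
    linarith
  have hsN : s * N + 2 < t * N := by
    have := mul_lt_mul_of_pos_right hst hN
    rw [add_mul] at this
    linarith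
  have htN : t * N ≤ N := by
    have := mul_le_mul_of_nonneg_right ht hN.le
    linarith
  have hlt : ⌊s * N⌋₊ + 1 < N := by
    have : ((⌊s * N⌋₊ + 1 : ℕ) : ℝ) < N := by
      push_cast
      linarith
    exact_mod_cast this
  -- The cell after the one containing `s` starts beyond `s` and ends at most `2 / N` beyond it,
  -- hence before `t`.
  obtain ⟨τ, hτ, h1, h2⟩ := hk ⟨_, hlt⟩
  refine ⟨τ, 𝒯.levels_subset_nodes m (𝒯.levels_mono
    ((Finset.le_sup (Finset.mem_univ (⟨_, hlt⟩ : Fin N))).trans hm) hτ), ?_, ?_⟩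
  · refine lt_trans ?_ h1
    rw [lt_div_iff₀ hN]
    push_cast
    linarith
  · refine h2.trans ?_
    rw [div_lt_iff₀ hN]
    push_cast
    linarith

/-- Near a level that is not a node, the interpolated quantile function is continuous. -/
theorem continuousAt_quantile (v : ℕ → ℝ → ℝ) (h : τ ∉ 𝒯.nodes m) :
    ContinuousAt (𝒯.quantile v m) τ := by
  -- Points close to `τ` lie on the same side of every node, hence in the same band, where the
  -- function is affine.
  have hev : ∀ᶠ s in 𝓝 τ, ∀ c ∈ 𝒯.nodes m, s ≠ c ∧ (c < s ↔ c < τ) ∧ (s < c ↔ τ < c) := by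
    rw [Filter.eventually_all_finset]
    intro c hc
    rcases lt_trichotomy c τ with hcτ | rfl | hcτ
    · filter_upwards [lt_mem_nhds hcτ] with s hs
      exact ⟨hs.ne', ⟨fun _ => hcτ, fun _ => hs⟩, ⟨fun h => absurd h hs.not_gt,
        fun h => absurd h hcτ.not_gt⟩⟩
    · exact absurd hc h
    · filter_upwards [gt_mem_nhds hcτ] with s hs
      exact ⟨hs.ne, ⟨fun h => absurd h hs.not_gt, fun h => absurd h hcτ.not_gt⟩,
        ⟨fun _ => hcτ, fun _ => hs⟩⟩
  have heq : 𝒯.quantile v m =ᶠ[𝓝 τ] fun s => 𝒯.nodeQuantile v m (𝒯.lower m τ) +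
      (𝒯.nodeQuantile v m (𝒯.upper m τ) - 𝒯.nodeQuantile v m (𝒯.lower m τ)) *
        (s - 𝒯.lower m τ) / (𝒯.upper m τ - 𝒯.lower m τ) := by
    filter_upwards [hev] with s hs
    have hsm : s ∉ 𝒯.nodes m := fun hsm => (hs s hsm).1 rfl
    have el : 𝒯.lower m s = 𝒯.lower m τ :=
      congrArg sSup (Set.ext fun c => and_congr_right fun hc => (hs c hc).2.1)
    have eu : 𝒯.upper m s = 𝒯.upper m τ :=
      congrArg sInf (Set.ext fun c => and_congr_right fun hc => (hs c hc).2.2)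
    rw [quantile, if_neg hsm, el, eu]
  refine ContinuousAt.congr ?_ heq.symm
  fun_prop

end Scheme

/-! ### Limits of the finite pyramids -/

variable {𝒳 Ω : Type*} {𝒯 : Scheme} {V : ℕ → 𝒳 → ℝ → Ω → ℝ}

/-- The process of infinite quantile pyramids. -/
def limitPyramid (𝒯 : Scheme) (V : ℕ → 𝒳 → ℝ → Ω → ℝ) (x : 𝒳) (ω : Ω) : UnitDist :=
  UnitDist.ofQuantile (𝒯.limitQuantile fun k s => V k x s ω)

theorem dist_fdqp_limitPyramid_le {x : 𝒳} {ω : Ω} (hv : 𝒯.IsWeight fun m s => V m x s ω) {m : ℕ}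
    {ε : ℝ} (hε : 0 < ε) (hm : ∀ s t : ℝ, 0 ≤ s → t ≤ 1 → s + ε < t →
      ∃ τ ∈ 𝒯.nodes m, s < τ ∧ τ < t) :
    dist (fdqp 𝒯 V m x ω) (limitPyramid 𝒯 V x ω) ≤ ε :=
  UnitDist.dist_ofQuantile_le (N := 𝒯.nodes m) hε hm
    (fun _ hτ => Scheme.quantile_eq_limitQuantile _ hτ)
    (fun _ hτ _ hσ hστ => Scheme.quantile_le_of_lt_node hv hτ hσ hστ)
    (fun _ hτ _ _ hστ => Scheme.limitQuantile_le_of_lt_node hv hτ hστ)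

/-- The specified quantiles are quantiles of the limit. -/
theorem limitPyramid_isQuantile {x : 𝒳} {ω : Ω} (hv : 𝒯.IsWeight fun m s => V m x s ω) {m : ℕ}
    {τ : ℝ} (hτ : τ ∈ 𝒯.nodes m) :
    τ ≤ (limitPyramid 𝒯 V x ω).cdf (fdqpQuantile 𝒯 V m x ω τ) ∧
      ∀ y < fdqpQuantile 𝒯 V m x ω τ, (limitPyramid 𝒯 V x ω).cdf y ≤ τ := by
  have hI := 𝒯.nodes_mem_Icc hτ
  have hlim := Scheme.limitQuantile_of_mem (fun m s => V m x s ω) hτ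
  have hQI := Scheme.nodeQuantile_mem_Icc hv hτ
  rw [fdqpQuantile, Scheme.quantile_eq_limitQuantile _ hτ]
  rw [← hlim] at hQI
  exact ⟨UnitDist.le_quantileInv hQI.1 hI.2 fun σ _ hστ =>
      Scheme.limitQuantile_le_of_lt_node hv hτ hστ,
    fun y hy => UnitDist.quantileInv_le hI (hy.trans_le hQI.2) hy⟩

/-! ### Measurability of the finite pyramids and of their limits -/

variable [MeasurableSpace Ω]

theorem measurable_nodeQuantile (hV : ∀ m x s, Measurable (V m x s)) (x : 𝒳) (m : ℕ) (τ : ℝ) :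
    Measurable fun ω => 𝒯.nodeQuantile (fun k s => V k x s ω) m τ := by
  induction m generalizing τ with
  | zero => exact measurable_const
  | succ m ih =>
    by_cases h : τ ∈ 𝒯.nodes m
    · simp only [Scheme.nodeQuantile, h, if_true]
      exact ih τ
    · simp only [Scheme.nodeQuantile_succ_of_notMem _ h, Scheme.partialWeight]
      exact (ih _).add (((ih _).sub (ih _)).mul
        (Finset.measurable_fun_sum _ fun s _ => hV (m + 1) x s))

theorem measurable_fdqpQuantile (hV : ∀ m x s, Measurable (V m x s)) (x : 𝒳) (m : ℕ) (τ : ℝ) :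
    Measurable fun ω => fdqpQuantile 𝒯 V m x ω τ := by
  have hn := measurable_nodeQuantile (𝒯 := 𝒯) hV x m
  by_cases h : τ ∈ 𝒯.nodes m
  · simp only [fdqpQuantile, Scheme.quantile, h, if_true]
    exact hn τ
  · simp only [fdqpQuantile, Scheme.quantile, h, if_false]
    exact (hn _).add ((((hn _).sub (hn _)).mul_const _).div_const _)

theorem measurable_fdqp (hV : ∀ m x s, Measurable (V m x s)) (m : ℕ) (x : 𝒳) :
    Measurable fun ω => fdqp 𝒯 V m x ω := by
  refine UnitDist.measurable_ofQuantile
    (C := Set.range ((↑) : ℚ → ℝ) ∪ (𝒯.nodes m : Set ℝ))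
    ((Set.countable_range _).union (Finset.countable_toSet _))
    (fun τ _ => measurable_fdqpQuantile hV x m τ) fun ω y hy r τ hτ h1 h2 => ?_
  -- Nodes are already in the countable set; any other witness can be moved to a nearby rational by
  -- continuity.
  by_cases h : τ ∈ 𝒯.nodes m
  · exact ⟨τ, Or.inr h, hτ, h1, h2⟩
  have hI := Scheme.mem_Ioo_of_notMem_nodes hτ h
  have hev : ∀ᶠ s in 𝓝 τ, s ∈ Set.Ioo (0 : ℝ) 1 ∧ y < fdqpQuantile 𝒯 V m x ω s ∧ s < r :=
    Filter.Eventually.and (Ioo_mem_nhds hI.1 hI.2)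
      (((Scheme.continuousAt_quantile _ h).eventually_const_lt h1).and (gt_mem_nhds h2))
  obtain ⟨q, hq⟩ := Rat.denseRange_cast.mem_nhds hev
  exact ⟨q, Or.inl ⟨q, rfl⟩, Set.Ioo_subset_Icc_self hq.1, hq.2⟩

theorem measurable_limitPyramid (hV : ∀ m x s, Measurable (V m x s)) (x : 𝒳) :
    Measurable (limitPyramid 𝒯 V x) := by
  refine UnitDist.measurable_ofQuantile (C := ⋃ m, (𝒯.nodes m : Set ℝ))
    (Set.countable_iUnion fun m => Finset.countable_toSet _) (fun τ hτ => ?_)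
    fun ω y hy r τ hτ h1 h2 => ?_
  · obtain ⟨m, hm⟩ := Set.mem_iUnion.1 hτ
    simp only [Scheme.limitQuantile_of_mem _ (Finset.mem_coe.1 hm)]
    exact measurable_nodeQuantile hV x m τ
  · refine ⟨τ, ?_, hτ, h1, h2⟩
    -- At an unspecified level the value is 0 and cannot exceed `y ≥ 0`, so every witness is a node.
    by_contra hτC
    rw [Scheme.limitQuantile_of_forall_notMem _ fun m hm =>
      hτC (Set.mem_iUnion.2 ⟨m, hm⟩)] at h1
    linarith

end QuantilePyramid

/-! ### Assembly of the theorem -/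

namespace QuantilePyramid

theorem tendsto_zero_of_forall_eventually_le {u : ℕ → ℝ} (h0 : ∀ n, 0 ≤ u n)
    (h : ∀ ε > 0, ∀ᶠ n in atTop, u n ≤ ε) : Tendsto u atTop (𝓝 0) := by
  refine Metric.tendsto_nhds.2 fun ε hε => ?_
  filter_upwards [h (ε / 2) (half_pos hε)] with n hn
  rw [Real.dist_0_eq_abs, abs_of_nonneg (h0 n)]
  linarith

end QuantilePyramid

end

open QuantilePyramid in
theorem theorem2 {𝒳 Ω : Type*} [MeasurableSpace Ω] (P : Measure Ω) [IsProbabilityMeasure P]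
    (𝒯 : Scheme) (V : ℕ → 𝒳 → ℝ → Ω → ℝ)
    (hV_meas : ∀ m x s, Measurable (V m x s))
    (hV : ∀ x, ∀ᵐ ω ∂P, 𝒯.IsWeight fun m s => V m x s ω)
    (h_dense : Set.Icc (0 : ℝ) 1 ⊆ closure (⋃ m, (𝒯.levels m : Set ℝ))) :
    ∃ μ : ∀ S : Finset 𝒳, Measure (S → UnitDist),
      -- for every finite `S`, the laws of the finite pyramids converge to the law `μ S`, and to
      -- no other law
      (∀ S : Finset 𝒳, IsProbabilityMeasure (μ S) ∧
        Tendsto (fun m => jointProkhorov S (fdqpLaw P 𝒯 V m S) (μ S)) atTop (𝓝 0) ∧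
        Tendsto (fun m => supProkhorov S (fdqpLaw P 𝒯 V m S) (μ S)) atTop (𝓝 0) ∧
        ∀ ν : Measure (S → UnitDist), IsProbabilityMeasure ν →
          Tendsto (fun m => jointProkhorov S (fdqpLaw P 𝒯 V m S) ν) atTop (𝓝 0) → ν = μ S) ∧
      -- these laws are consistent
      IsProjectiveMeasureFamily (α := fun _ : 𝒳 => UnitDist) μ ∧
      -- they are the finite-dimensional laws of a process of quantile pyramids indexed by `𝒳`,
      -- the limit of the finite pyramids
      ∃ F : 𝒳 → Ω → UnitDist,
        (∀ x, Measurable (F x)) ∧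
        (∀ x, ∀ᵐ ω ∂P,
          Tendsto (fun m => fdqp 𝒯 V m x ω) atTop (𝓝 (F x ω)) ∧
          ∀ m, ∀ τ ∈ 𝒯.levels m,
            τ ≤ (F x ω).cdf (fdqpQuantile 𝒯 V m x ω τ) ∧
            ∀ y < fdqpQuantile 𝒯 V m x ω τ, (F x ω).cdf y ≤ τ) ∧
        ∀ S : Finset 𝒳, P.map (fun ω (x : S) => F x ω) = μ S := by
  have hm : ∀ m, ∀ S : Finset 𝒳, Measurable fun ω (x : S) => fdqp 𝒯 V m x ω := fun m S =>
    measurable_pi_lambda _ fun x => measurable_fdqp hV_meas m x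
  have hF : ∀ S : Finset 𝒳, Measurable fun ω (x : S) => limitPyramid 𝒯 V x ω := fun S =>
    measurable_pi_lambda _ fun x => measurable_limitPyramid hV_meas x
  have hlaw : ∀ m S, IsProbabilityMeasure (fdqpLaw P 𝒯 V m S) := fun m S =>
    Measure.isProbabilityMeasure_map (hm m S).aemeasurable
  -- The threshold in `m` precedes both `x` and `ω`, which is what turns the pathwise bound into
  -- bounds on the laws.
  have hdist : ∀ ε > 0, ∀ᶠ m in atTop, ∀ x, ∀ᵐ ω ∂P,
      dist (fdqp 𝒯 V m x ω) (limitPyramid 𝒯 V x ω) ≤ ε := fun ε hε => by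
    obtain ⟨M, hM⟩ := Scheme.exists_forall_exists_node h_dense hε
    filter_upwards [eventually_ge_atTop M] with m hmM x
    filter_upwards [hV x] with ω hω
    exact dist_fdqp_limitPyramid_le hω hε (hM m hmM)
  have hjoint : ∀ S : Finset 𝒳, Tendsto (fun m => jointProkhorov S (fdqpLaw P 𝒯 V m S)
      (P.map fun ω (x : S) => limitPyramid 𝒯 V x ω)) atTop (𝓝 0) := fun S => by
    refine tendsto_zero_of_forall_eventually_le (fun m => levyProkhorovDist_nonneg _ _)
      fun ε hε => ?_
    filter_upwards [hdist ε hε] with m hdm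
    refine levyProkhorovDist_map_le (hm m S) (hF S) hε.le ?_
    -- The exceptional null set depends on `x`; as `S` is finite, the union over `S` is still null.
    filter_upwards [ae_all_iff.2 fun x : S => hdm x] with ω hω
    exact (dist_pi_le_iff hε.le).2 hω
  refine ⟨fun S => P.map fun ω (x : S) => limitPyramid 𝒯 V x ω, fun S => ?_, fun I J hJI => ?_,
    limitPyramid 𝒯 V, measurable_limitPyramid hV_meas, fun x => ?_, fun S => rfl⟩
  · have hprob : IsProbabilityMeasure (P.map fun ω (x : S) => limitPyramid 𝒯 V x ω) :=
      Measure.isProbabilityMeasure_map (hF S).aemeasurable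
    refine ⟨hprob, hjoint S, ?_, fun ν _ hν => eq_of_tendsto_levyProkhorovDist (hjoint S) hν⟩
    refine tendsto_zero_of_forall_eventually_le
      (fun m => Real.iSup_nonneg fun x => levyProkhorovDist_nonneg _ _) fun ε hε => ?_
    filter_upwards [hdist ε hε] with m hdm
    refine Real.iSup_le (fun x => ?_) hε.le
    rw [fdqpLaw, Measure.map_map (measurable_pi_apply x) (hm m S),
      Measure.map_map (measurable_pi_apply x) (hF S)]
    exact levyProkhorovDist_map_le (measurable_fdqp hV_meas m x)
      (measurable_limitPyramid hV_meas x) hε.le (hdm x)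
  · have hr : Measurable (Finset.restrict₂ (π := fun _ : 𝒳 => UnitDist) hJI) :=
      Finset.measurable_restrict₂ hJI
    exact (Measure.map_map hr (hF I)).symm
  -- Only the weights at `x` can fail, so one null set serves every ε and every specified level.
  · filter_upwards [hV x] with ω hω
    refine ⟨?_, fun m τ hτ => limitPyramid_isQuantile hω (𝒯.levels_subset_nodes m hτ)⟩
    refine tendsto_iff_dist_tendsto_zero.2 (tendsto_zero_of_forall_eventually_le
      (fun m => dist_nonneg) fun ε hε => ?_)
    obtain ⟨M, hM⟩ := Scheme.exists_forall_exists_node h_dense hε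
    filter_upwards [eventually_ge_atTop M] with m hmM
    exact dist_fdqp_limitPyramid_le hω hε (hM m hmM)
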